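/- For $a,b>0$ let $X_{a,b}$ be a random variable with the Beta distribution $\mathrm{Beta}(a,b)$, i.e. with density $x^{a-1}(1-x)^{b-1}/B(a,b)$ on $(0,1)$, where $B(a,b)=\int_0^1 y^{a-1}(1-y)^{b-1}\,dy$. The mode (respectively anti-mode) of an absolutely continuous distribution is the unique maximizer (respectively minimizer), on the support of the distribution, of its density, taken to be continuous there; the density may take the value $+\infty$ at points of the support, as the $\mathrm{Beta}(a,b)$ density does at $0$ and $1$ when $a,b<1$. (1) For all $a,b>1$ the distribution $\mathrm{Beta}(a,b)$ has exactly one mode $\mathrm{mode}(X_{a,b})$, and the map $(a,b)\mapsto \mathbb{P}(X_{a,b}>\mathrm{mode}(X_{a,b}))$ on $(1,\infty)^2$ is decreasing in $a$ and increasing in $b$. (2) For all $0<a,b<1$ the distribution $\mathrm{Beta}(a,b)$ has exactly one anti-mode $\mathrm{antimode}(X_{a,b})$, and the map $(a,b)\mapsto \mathbb{P}(X_{a,b}>\mathrm{antimode}(X_{a,b}))$ on $(0,1)^2$ is increasing in $a$ and decreasing in $b$. Here "increasing" and "decreasing" are meant in the non-strict sense. -/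

import Mathlib

open MeasureTheory ProbabilityTheory Set
open scoped ENNReal

/-- `f` is a continuous (extended-valued) density of `P`: a density of `P` with respect to
Lebesgue measure that is continuous on the support of `P`. The value `∞` is allowed so that a
density that blows up at an end point of the support, such as `x ↦ C / √(x (1 - x))` on `[0, 1]`,
is continuous on the whole support. Such an `f` is uniquely determined on the support of `P`. -/
structure IsContinuousDensity (P : Measure ℝ) (f : ℝ → ℝ≥0∞) : Prop where
  measurable : Measurable f
  eq_withDensity : P = volume.withDensity f
  continuousOn : ContinuousOn f P.support

/-- `m` is the mode of `P`: the unique maximizer, on the support of `P`, of a continuous density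
of `P`. In particular `P` is absolutely continuous and unimodal. -/
def IsMode (P : Measure ℝ) (m : ℝ) : Prop :=
  ∃ f : ℝ → ℝ≥0∞, IsContinuousDensity P f ∧
    m ∈ P.support ∧ ∀ x ∈ P.support, x ≠ m → f x < f m

/-- `m` is the anti-mode of `P`: the unique minimizer, on the support of `P`, of a continuous
density of `P`. In particular `P` is absolutely continuous and uniantimodal. -/
def IsAntimode (P : Measure ℝ) (m : ℝ) : Prop :=
  ∃ f : ℝ → ℝ≥0∞, IsContinuousDensity P f ∧
    m ∈ P.support ∧ ∀ x ∈ P.support, x ≠ m → f m < f x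

/-! Put α = a - 1, β = b - 1. In both regimes the critical point is m = α / (α + β), by weighted
AM-GM, inverted when α, β < 0. Split the mass at m: up to a common factor the part above m is U =
`sideMass β α` and the part below is L = `sideMass α β`, so the probability is U / (U + L).
Exchanging a and b exchanges U and L, so it is enough to vary α and compare U with L through cross
products.

For α, β < 0 the two parts move in opposite directions: as α grows, |U| grows and |L| shrinks,
already at the level of integrands.

For α, β > 0 both parts grow with α and their rates must be compared. For α ≤ α' let k = U(α) /
U(α'); the claim is L(α) ≤ k L(α'). After the kernel for α is rescaled by k, comparing logarithmic
derivatives with the kernel for α' amounts to the sign of one quadratic Q, at u above the mode and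
at -u below it. Equality of the upper areas forces Q > 0 somewhere above. Since Q is convex and
negative at the upper end β, it is then positive on the whole lower side, which gives the claim
(`sideMass_mul_sideMass_le_of_pos`). -/

/-! ### Support and continuous density of the Beta distribution -/

theorem support_betaMeasure {a b : ℝ} (ha : 0 < a) (hb : 0 < b) :
    (betaMeasure a b).support = Icc 0 1 := by
  apply Subset.antisymm
  · apply Measure.support_subset_of_isClosed isClosed_Icc
    rw [mem_ae_iff, betaMeasure, withDensity_apply _ measurableSet_Icc.compl]
    refine setLIntegral_eq_zero measurableSet_Icc.compl fun x hx => ?_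
    rcases le_or_gt x 0 with h | h
    · exact betaPDF_eq_zero_of_nonpos h
    · exact betaPDF_eq_zero_of_one_le (not_lt.1 fun h1 => hx ⟨h.le, h1.le⟩)
  · rw [← closure_Ioo (zero_ne_one' ℝ)]
    refine closure_minimal (fun x hx => ?_) Measure.isClosed_support
    rw [Measure.support_eq_forall_isOpen]
    intro u hxu hu
    have hpos : ∀ y ∈ u ∩ Ioo 0 1, betaPDF a b y ≠ 0 := fun y hy =>
      (ENNReal.ofReal_pos.2 (betaPDFReal_pos hy.2.1 hy.2.2 ha hb)).ne'
    have hopen : IsOpen (u ∩ Ioo (0 : ℝ) 1) := hu.inter isOpen_Ioo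
    rw [pos_iff_ne_zero, betaMeasure]
    intro h0
    have hm : Measurable (betaPDF a b) := (measurable_betaPDFReal a b).ennreal_ofReal
    rw [withDensity_apply_eq_zero hm] at h0
    refine (hopen.measure_pos volume ⟨x, hxu, hx⟩).ne' (measure_mono_null (fun y hy => ?_) h0)
    exact ⟨hpos y hy, hy.1⟩

/-- The density of the Beta distribution on `[0, 1]`, with its limiting values at `0` and `1`. -/
noncomputable def betaDensity (a b x : ℝ) : ℝ≥0∞ :=
  (Icc (0 : ℝ) 1).indicator (fun x => ENNReal.ofReal (1 / beta a b) *
    (ENNReal.ofReal x ^ (a - 1) * ENNReal.ofReal (1 - x) ^ (b - 1))) x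

theorem betaDensity_of_mem_Icc {a b x : ℝ} (hx : x ∈ Icc (0 : ℝ) 1) :
    betaDensity a b x = ENNReal.ofReal (1 / beta a b) *
      (ENNReal.ofReal x ^ (a - 1) * ENNReal.ofReal (1 - x) ^ (b - 1)) :=
  indicator_of_mem hx _

theorem betaDensity_of_mem_Ioo {a b x : ℝ} (ha : 0 < a) (hb : 0 < b) (hx : x ∈ Ioo (0 : ℝ) 1) :
    betaDensity a b x =
      ENNReal.ofReal (1 / beta a b * x ^ (a - 1) * (1 - x) ^ (b - 1)) := by
  have h1 : 0 < 1 - x := sub_pos.2 hx.2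
  have h2 := one_div_pos.2 (beta_pos ha hb)
  rw [betaDensity_of_mem_Icc ⟨hx.1.le, hx.2.le⟩, ENNReal.ofReal_rpow_of_pos hx.1,
    ENNReal.ofReal_rpow_of_pos h1, ← ENNReal.ofReal_mul (Real.rpow_nonneg hx.1.le _),
    ← ENNReal.ofReal_mul h2.le, mul_assoc]

theorem continuousOn_betaDensity (a b : ℝ) : ContinuousOn (betaDensity a b) (Icc 0 1) := by
  refine ContinuousOn.congr ?_ fun x hx => betaDensity_of_mem_Icc hx
  intro x hx
  have h1 : Filter.Tendsto (fun x : ℝ => ENNReal.ofReal x ^ (a - 1)) (nhds x)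
      (nhds (ENNReal.ofReal x ^ (a - 1))) :=
    (ENNReal.continuous_rpow_const.comp ENNReal.continuous_ofReal).tendsto x
  have h2 : Filter.Tendsto (fun x : ℝ => ENNReal.ofReal (1 - x) ^ (b - 1)) (nhds x)
      (nhds (ENNReal.ofReal (1 - x) ^ (b - 1))) :=
    (ENNReal.continuous_rpow_const.comp
      (ENNReal.continuous_ofReal.comp (continuous_const.sub continuous_id))).tendsto x
  have key : ∀ {y c : ℝ}, 0 < y → ENNReal.ofReal y ^ c ≠ 0 ∧ ENNReal.ofReal y ^ c ≠ ∞ := by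
    intro y c hy
    rw [ENNReal.ofReal_rpow_of_pos hy]
    exact ⟨(ENNReal.ofReal_pos.2 (Real.rpow_pos_of_pos hy c)).ne', ENNReal.ofReal_ne_top⟩
  refine (ENNReal.Tendsto.const_mul ?_ (Or.inr ENNReal.ofReal_ne_top)).mono_left
    nhdsWithin_le_nhds
  -- Multiplication on `ℝ≥0∞` is discontinuous at (0, ∞), but x and 1 - x are not both 0, so one
  -- factor is always positive and finite.
  rcases hx.1.lt_or_eq with h0 | h0
  · exact ENNReal.Tendsto.mul h1 (Or.inl (key h0).1) h2 (Or.inr (key h0).2)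
  · have : 0 < 1 - x := by linarith
    exact ENNReal.Tendsto.mul h1 (Or.inr (key this).2) h2 (Or.inl (key this).1)

theorem isContinuousDensity_betaDensity {a b : ℝ} (ha : 0 < a) (hb : 0 < b) :
    IsContinuousDensity (betaMeasure a b) (betaDensity a b) where
  measurable := by
    refine Measurable.indicator ?_ measurableSet_Icc
    fun_prop
  continuousOn := by
    rw [support_betaMeasure ha hb]
    exact continuousOn_betaDensity a b
  eq_withDensity := by
    refine withDensity_congr_ae ?_
    have h0 : ∀ᵐ x : ℝ, x ≠ 0 := by simp [ae_iff]
    have h1 : ∀ᵐ x : ℝ, x ≠ 1 := by simp [ae_iff]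
    filter_upwards [h0, h1] with x hx0 hx1
    by_cases hx : x ∈ Ioo (0 : ℝ) 1
    · rw [betaDensity_of_mem_Ioo ha hb hx, betaPDF_of_pos_lt_one hx.1 hx.2]
    · have hx' : x ∉ Icc (0 : ℝ) 1 := fun h =>
        hx ⟨lt_of_le_of_ne h.1 (Ne.symm hx0), lt_of_le_of_ne h.2 hx1⟩
      rw [betaDensity, indicator_of_notMem hx', betaPDF_eq, if_neg (show ¬(0 < x ∧ x < 1) from hx), ENNReal.ofReal_zero]

/-- Continuous functions equal almost everywhere on [0, 1] agree at every point, endpoints included.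
This reduces modes and anti-modes to a single explicit function. -/
theorem IsContinuousDensity.eqOn_betaDensity {a b : ℝ} (ha : 0 < a) (hb : 0 < b)
    {f : ℝ → ℝ≥0∞} (hf : IsContinuousDensity (betaMeasure a b) f) :
    EqOn f (betaDensity a b) (Icc 0 1) := by
  have hg := isContinuousDensity_betaDensity ha hb
  have hae : f =ᵐ[volume] betaDensity a b :=
    (withDensity_eq_iff_of_sigmaFinite hf.measurable.aemeasurable hg.measurable.aemeasurable).1
      (hf.eq_withDensity.symm.trans hg.eq_withDensity)
  have hc := hf.continuousOn
  rw [support_betaMeasure ha hb] at hc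
  exact Measure.eqOn_Icc_of_ae_eq volume zero_ne_one (ae_restrict_of_ae hae) hc
    (continuousOn_betaDensity a b)

theorem isMode_betaMeasure_iff {a b : ℝ} (ha : 0 < a) (hb : 0 < b) (m : ℝ) :
    IsMode (betaMeasure a b) m ↔
      m ∈ Icc (0 : ℝ) 1 ∧ ∀ x ∈ Icc (0 : ℝ) 1, x ≠ m → betaDensity a b x < betaDensity a b m := by
  constructor
  · rintro ⟨f, hf, hm, h⟩
    rw [support_betaMeasure ha hb] at hm h
    have he := hf.eqOn_betaDensity ha hb
    exact ⟨hm, fun x hx hne => by rw [← he hx, ← he hm]; exact h x hx hne⟩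
  · intro h
    refine ⟨betaDensity a b, isContinuousDensity_betaDensity ha hb, ?_⟩
    rwa [support_betaMeasure ha hb]

theorem isAntimode_betaMeasure_iff {a b : ℝ} (ha : 0 < a) (hb : 0 < b) (m : ℝ) :
    IsAntimode (betaMeasure a b) m ↔
      m ∈ Icc (0 : ℝ) 1 ∧ ∀ x ∈ Icc (0 : ℝ) 1, x ≠ m → betaDensity a b m < betaDensity a b x := by
  constructor
  · rintro ⟨f, hf, hm, h⟩
    rw [support_betaMeasure ha hb] at hm h
    have he := hf.eqOn_betaDensity ha hb
    exact ⟨hm, fun x hx hne => by rw [← he hx, ← he hm]; exact h x hx hne⟩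
  · intro h
    refine ⟨betaDensity a b, isContinuousDensity_betaDensity ha hb, ?_⟩
    rwa [support_betaMeasure ha hb]

theorem eq_of_isMode_betaMeasure {a b m m' : ℝ} (ha : 0 < a) (hb : 0 < b)
    (h : IsMode (betaMeasure a b) m) (h' : IsMode (betaMeasure a b) m') : m = m' := by
  rw [isMode_betaMeasure_iff ha hb] at h h'
  by_contra hne
  exact lt_asymm (h.2 m' h'.1 (Ne.symm hne)) (h'.2 m h.1 hne)

theorem eq_of_isAntimode_betaMeasure {a b m m' : ℝ} (ha : 0 < a) (hb : 0 < b)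
    (h : IsAntimode (betaMeasure a b) m) (h' : IsAntimode (betaMeasure a b) m') : m = m' := by
  rw [isAntimode_betaMeasure_iff ha hb] at h h'
  by_contra hne
  exact lt_asymm (h.2 m' h'.1 (Ne.symm hne)) (h'.2 m h.1 hne)

/-! ### Location of the mode and the anti-mode -/

/-- Weighted AM-GM: `x ^ α * (1 - x) ^ β` has its strict maximum at `α / (α + β)`. -/
theorem rpow_mul_one_sub_rpow_lt {α β x : ℝ} (hα : 0 < α) (hβ : 0 < β) (hx : x ∈ Ioo (0 : ℝ) 1)
    (hne : x ≠ α / (α + β)) :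
    x ^ α * (1 - x) ^ β < (α / (α + β)) ^ α * (1 - α / (α + β)) ^ β := by
  have hs : 0 < α + β := add_pos hα hβ
  have hx1 : 0 < 1 - x := sub_pos.2 hx.2
  have hm : 0 < α / (α + β) := div_pos hα hs
  have hm' : 1 - α / (α + β) = β / (α + β) := by field_simp; ring
  have hm1 : 0 < β / (α + β) := div_pos hβ hs
  have e1 : x / (α / (α + β)) = x * (α + β) / α := by field_simp
  have e2 : (1 - x) / (β / (α + β)) = (1 - x) * (α + β) / β := by field_simp
  have l1 : Real.log (x / (α / (α + β))) < x / (α / (α + β)) - 1 :=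
    Real.log_lt_sub_one_of_pos (div_pos hx.1 hm) (by rwa [Ne, div_eq_one_iff_eq hm.ne'])
  have l2 : Real.log ((1 - x) / (β / (α + β))) ≤ (1 - x) / (β / (α + β)) - 1 :=
    Real.log_le_sub_one_of_pos (div_pos hx1 hm1)
  rw [Real.log_div hx.1.ne' hm.ne', e1] at l1
  rw [Real.log_div hx1.ne' hm1.ne', e2] at l2
  have k1 := mul_lt_mul_of_pos_left l1 hα
  have k2 := mul_le_mul_of_nonneg_left l2 hβ.le
  have k3 : α * (x * (α + β) / α - 1) + β * ((1 - x) * (α + β) / β - 1) = 0 := by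
    field_simp; ring
  rw [hm', Real.rpow_def_of_pos hx.1, Real.rpow_def_of_pos hx1, Real.rpow_def_of_pos hm,
    Real.rpow_def_of_pos hm1, ← Real.exp_add, ← Real.exp_add, Real.exp_lt_exp]
  linarith

theorem div_add_mem_Ioo {α β : ℝ} (h : 0 < α ∧ 0 < β ∨ α < 0 ∧ β < 0) :
    α / (α + β) ∈ Ioo (0 : ℝ) 1 := by
  rcases h with ⟨h1, h2⟩ | ⟨h1, h2⟩
  · exact ⟨div_pos h1 (add_pos h1 h2), (div_lt_one (add_pos h1 h2)).2 (by linarith)⟩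
  · exact ⟨div_pos_of_neg_of_neg h1 (add_neg h1 h2),
      (div_lt_one_of_neg (add_neg h1 h2)).2 (by linarith)⟩

theorem isMode_betaMeasure {a b : ℝ} (ha : 1 < a) (hb : 1 < b) :
    IsMode (betaMeasure a b) ((a - 1) / ((a - 1) + (b - 1))) := by
  have ha0 : 0 < a := by linarith
  have hb0 : 0 < b := by linarith
  have hα : 0 < a - 1 := by linarith
  have hβ : 0 < b - 1 := by linarith
  have hc := one_div_pos.2 (beta_pos ha0 hb0)
  have hm := div_add_mem_Ioo (Or.inl ⟨hα, hβ⟩)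
  refine (isMode_betaMeasure_iff ha0 hb0 _).2 ⟨Ioo_subset_Icc_self hm, fun x hx hne => ?_⟩
  rw [betaDensity_of_mem_Ioo ha0 hb0 hm, mul_assoc]
  have hpos : 0 < 1 / beta a b * (((a - 1) / ((a - 1) + (b - 1))) ^ (a - 1) *
      (1 - (a - 1) / ((a - 1) + (b - 1))) ^ (b - 1)) :=
    mul_pos hc (mul_pos (Real.rpow_pos_of_pos hm.1 _) (Real.rpow_pos_of_pos (sub_pos.2 hm.2) _))
  rcases hx.1.eq_or_lt with rfl | h0
  · rw [betaDensity_of_mem_Icc hx]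
    simpa [hα] using hpos
  rcases hx.2.eq_or_lt with rfl | h1
  · rw [betaDensity_of_mem_Icc hx]
    simpa [hβ] using hpos
  rw [betaDensity_of_mem_Ioo ha0 hb0 ⟨h0, h1⟩, ENNReal.ofReal_lt_ofReal_iff hpos, mul_assoc]
  exact mul_lt_mul_of_pos_left (rpow_mul_one_sub_rpow_lt hα hβ ⟨h0, h1⟩ hne) hc

theorem isAntimode_betaMeasure {a b : ℝ} (ha : a ∈ Ioo (0 : ℝ) 1) (hb : b ∈ Ioo (0 : ℝ) 1) :
    IsAntimode (betaMeasure a b) ((a - 1) / ((a - 1) + (b - 1))) := by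
  have hα : a - 1 < 0 := sub_neg.2 ha.2
  have hβ : b - 1 < 0 := sub_neg.2 hb.2
  have hc := one_div_pos.2 (beta_pos ha.1 hb.1)
  have hm := div_add_mem_Ioo (Or.inr ⟨hα, hβ⟩)
  refine (isAntimode_betaMeasure_iff ha.1 hb.1 _).2 ⟨Ioo_subset_Icc_self hm, fun x hx hne => ?_⟩
  rw [betaDensity_of_mem_Ioo ha.1 hb.1 hm]
  rcases hx.1.eq_or_lt with rfl | h0
  · rw [betaDensity_of_mem_Icc hx]
    simp [ENNReal.zero_rpow_of_neg hα, ENNReal.mul_top, beta_pos ha.1 hb.1]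
  rcases hx.2.eq_or_lt with rfl | h1
  · rw [betaDensity_of_mem_Icc hx]
    simp [ENNReal.zero_rpow_of_neg hβ, ENNReal.mul_top, beta_pos ha.1 hb.1]
  have hx1 : 0 < 1 - x := sub_pos.2 h1
  have hm1 := sub_pos.2 hm.2
  have hpos : ∀ y : ℝ, 0 < y → 0 < 1 - y →
      0 < 1 / beta a b * y ^ (a - 1) * (1 - y) ^ (b - 1) := fun y h h' =>
    mul_pos (mul_pos hc (Real.rpow_pos_of_pos h _)) (Real.rpow_pos_of_pos h' _)
  rw [betaDensity_of_mem_Ioo ha.1 hb.1 ⟨h0, h1⟩, ENNReal.ofReal_lt_ofReal_iff (hpos x h0 hx1),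
    mul_assoc, mul_assoc]
  refine mul_lt_mul_of_pos_left ?_ hc
  -- The density is the reciprocal of the AM-GM product with positive exponents 1 - a and 1 - b,
  -- whose maximum lies at the same point.
  have e : (1 - a) / ((1 - a) + (1 - b)) = (a - 1) / ((a - 1) + (b - 1)) := by
    rw [← neg_div_neg_eq]; congr 1 <;> ring
  have key := rpow_mul_one_sub_rpow_lt (neg_pos.2 hα) (neg_pos.2 hβ) ⟨h0, h1⟩
    (by rwa [neg_sub, neg_sub, e])
  rw [neg_sub, neg_sub, e, ← neg_sub a 1, ← neg_sub b 1, Real.rpow_neg h0.le,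
    Real.rpow_neg hx1.le, Real.rpow_neg hm.1.le, Real.rpow_neg hm1.le, ← mul_inv, ← mul_inv] at key
  refine (inv_lt_inv₀ ?_ ?_).1 key
  · exact mul_pos (Real.rpow_pos_of_pos h0 _) (Real.rpow_pos_of_pos hx1 _)
  · exact mul_pos (Real.rpow_pos_of_pos hm.1 _) (Real.rpow_pos_of_pos hm1 _)

/-! ### The mass on each side of the critical point -/

theorem integrable_betaPDFReal {a b : ℝ} (ha : 0 < a) (hb : 0 < b) :
    Integrable (betaPDFReal a b) := by
  refine ⟨(stronglyMeasurable_betaPDFReal a b).aestronglyMeasurable, ?_⟩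
  have hnn : ∀ x, 0 ≤ betaPDFReal a b x := fun x => by
    by_cases hx : 0 < x ∧ x < 1
    · exact (betaPDFReal_pos hx.1 hx.2 ha hb).le
    · rw [betaPDFReal, if_neg hx]
  rw [hasFiniteIntegral_iff_ofReal (.of_forall hnn)]
  exact (lintegral_betaPDF_eq_one ha hb).trans_lt ENNReal.one_lt_top

theorem intervalIntegrable_rpow_mul_one_sub_rpow {α β : ℝ} (hα : -1 < α) (hβ : -1 < β) :
    IntervalIntegrable (fun x : ℝ => x ^ α * (1 - x) ^ β) volume 0 1 := by
  have ha : 0 < α + 1 := by linarith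
  have hb : 0 < β + 1 := by linarith
  have hB := beta_pos ha hb
  rw [intervalIntegrable_iff_integrableOn_Ioo_of_le zero_le_one]
  refine IntegrableOn.congr_fun
    ((integrable_betaPDFReal ha hb).const_mul (beta (α + 1) (β + 1))).integrableOn
    (fun x hx => ?_) measurableSet_Ioo
  simp only [betaPDFReal]
  rw [if_pos (show 0 < x ∧ x < 1 from hx), add_sub_cancel_right, add_sub_cancel_right]
  field_simp

theorem betaMeasure_real_Ioo {a b l r : ℝ} (ha : 0 < a) (hb : 0 < b) (hl : 0 ≤ l) (hr : r ≤ 1)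
    (hlr : l ≤ r) :
    (betaMeasure a b).real (Ioo l r) =
      1 / beta a b * ∫ x in l..r, x ^ (a - 1) * (1 - x) ^ (b - 1) := by
  have hB := beta_pos ha hb
  rw [measureReal_def, betaMeasure, withDensity_apply _ measurableSet_Ioo,
    intervalIntegral.integral_of_le hlr, integral_Ioc_eq_integral_Ioo, ← integral_const_mul,
    integral_eq_lintegral_of_nonneg_ae]
  · congr 1
    refine setLIntegral_congr_fun measurableSet_Ioo fun x hx => ?_
    simp only [← mul_assoc]
    exact betaPDF_of_pos_lt_one (hl.trans_lt hx.1) (hx.2.trans_le hr)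
  · refine ae_restrict_of_forall_mem measurableSet_Ioo fun x hx => ?_
    have h0 : 0 < x := hl.trans_lt hx.1
    have h1 : 0 < 1 - x := sub_pos.2 (hx.2.trans_le hr)
    simp only [Pi.zero_apply]
    positivity
  · exact Measurable.aestronglyMeasurable (by fun_prop)

/-- The integral of `x ^ α * (1 - x) ^ β` from `0` to `m = α / (α + β)`, divided by `m` times the
value of the integrand at `m`. -/
noncomputable def sideIntegral (α β : ℝ) : ℝ :=
  ∫ s in (0 : ℝ)..1, s ^ α * (1 + α / β * (1 - s)) ^ β

theorem one_add_div_mul_one_sub_pos {α β s : ℝ} (h : 0 < α / β) (hs : s ≤ 1) :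
    0 < 1 + α / β * (1 - s) := by
  have := mul_nonneg h.le (sub_nonneg.2 hs)
  linarith

theorem intervalIntegrable_sideIntegral {α β : ℝ} (hα : -1 < α) (h : 0 < α / β) :
    IntervalIntegrable (fun s : ℝ => s ^ α * (1 + α / β * (1 - s)) ^ β) volume 0 1 := by
  refine (intervalIntegral.intervalIntegrable_rpow' hα).mul_continuousOn ?_
  rw [uIcc_of_le zero_le_one]
  exact ContinuousOn.rpow_const (by fun_prop)
    fun s hs => Or.inl (one_add_div_mul_one_sub_pos h hs.2).ne'

theorem sideIntegral_pos {α β : ℝ} (hα : -1 < α) (h : 0 < α / β) : 0 < sideIntegral α β :=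
  intervalIntegral.intervalIntegral_pos_of_pos_on (intervalIntegrable_sideIntegral hα h)
    (fun _ hs => mul_pos (Real.rpow_pos_of_pos hs.1 _)
      (Real.rpow_pos_of_pos (one_add_div_mul_one_sub_pos h hs.2.le) _)) one_pos

theorem integral_zero_mode {α β : ℝ} (h : 0 < α ∧ 0 < β ∨ α < 0 ∧ β < 0) :
    ∫ x in (0 : ℝ)..α / (α + β), x ^ α * (1 - x) ^ β =
      (α / (α + β)) ^ α * (β / (α + β)) ^ β * (α / (α + β) * sideIntegral α β) := by
  obtain ⟨hm0, hm1⟩ := div_add_mem_Ioo h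
  obtain ⟨hn0, -⟩ := div_add_mem_Ioo (h.imp And.symm And.symm)
  rw [add_comm β α] at hn0
  have hq : 0 < α / β := by
    rcases h with h | h
    · exact div_pos h.1 h.2
    · exact div_pos_of_neg_of_neg h.1 h.2
  have hβ : β ≠ 0 := by rcases h with h | h; exacts [h.2.ne', h.2.ne]
  have hs : α + β ≠ 0 := by rcases h with h | h <;> intro h' <;> linarith
  have := intervalIntegral.smul_integral_comp_mul_left (a := 0) (b := 1)
    (fun x : ℝ => x ^ α * (1 - x) ^ β) (α / (α + β))
  rw [mul_zero, mul_one] at this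
  rw [← this, smul_eq_mul, sideIntegral, mul_left_comm]
  congr 1
  rw [← intervalIntegral.integral_const_mul]
  refine intervalIntegral.integral_congr fun s hs' => ?_
  rw [uIcc_of_le zero_le_one] at hs'
  -- With x = m s, both factors of the integrand split off their value at m.
  have e : 1 - α / (α + β) * s = β / (α + β) * (1 + α / β * (1 - s)) := by
    field_simp; ring
  rw [e, Real.mul_rpow hm0.le hs'.1,
    Real.mul_rpow hn0.le (one_add_div_mul_one_sub_pos hq hs'.2).le]
  ring

theorem integral_mode_one {α β : ℝ} (h : 0 < α ∧ 0 < β ∨ α < 0 ∧ β < 0) :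
    ∫ x in α / (α + β)..1, x ^ α * (1 - x) ^ β =
      (α / (α + β)) ^ α * (β / (α + β)) ^ β * (β / (α + β) * sideIntegral β α) := by
  have hs : α + β ≠ 0 := by rcases h with h | h <;> intro h' <;> linarith
  have e : α / (α + β) = 1 - β / (β + α) := by rw [add_comm β α]; field_simp; ring
  have key := integral_zero_mode (α := β) (β := α) (h.imp And.symm And.symm)
  have := intervalIntegral.integral_comp_sub_left (a := 0) (b := β / (β + α))
    (fun x : ℝ => x ^ α * (1 - x) ^ β) 1
  rw [sub_zero, ← e] at this
  rw [← this, add_comm α β, mul_comm ((α / (β + α)) ^ α), ← key]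
  refine intervalIntegral.integral_congr fun s _ => ?_
  simp only [sub_sub_cancel]
  ring

theorem betaMeasure_real_Ioi_mode {a b : ℝ} (ha : 0 < a) (hb : 0 < b)
    (h : 0 < a - 1 ∧ 0 < b - 1 ∨ a - 1 < 0 ∧ b - 1 < 0) :
    (betaMeasure a b).real (Ioi ((a - 1) / ((a - 1) + (b - 1)))) =
      (b - 1) * sideIntegral (b - 1) (a - 1) /
        ((b - 1) * sideIntegral (b - 1) (a - 1) + (a - 1) * sideIntegral (a - 1) (b - 1)) := by
  obtain ⟨hm0, hm1⟩ := div_add_mem_Ioo h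
  have hnull : ∀ m : ℝ, 0 ≤ m →
      (betaMeasure a b).real (Ioi m) = (betaMeasure a b).real (Ioo m 1) := by
    intro m hm
    refine measureReal_congr ?_
    have : (betaMeasure a b) (Ici 1) = 0 := by
      rw [betaMeasure, withDensity_apply _ measurableSet_Ici]
      exact setLIntegral_eq_zero measurableSet_Ici fun x hx => betaPDF_eq_zero_of_one_le hx
    filter_upwards [measure_eq_zero_iff_ae_notMem.1 this] with x hx
    rw [mem_Ici, not_le] at hx
    exact propext ⟨fun hx' => ⟨hx', hx⟩, fun hx' => hx'.1⟩
  have h1 : (betaMeasure a b).real (Ioo 0 1) = 1 := by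
    have := isProbabilityMeasureBeta ha hb
    rw [← hnull 0 le_rfl, measureReal_def, prob_compl_eq_zero_iff measurableSet_Ioi |>.1,
      ENNReal.toReal_one]
    rw [compl_Ioi, betaMeasure, withDensity_apply _ measurableSet_Iic]
    exact setLIntegral_eq_zero measurableSet_Iic fun x hx => betaPDF_eq_zero_of_nonpos hx
  have hB := beta_pos ha hb
  have hint := intervalIntegrable_rpow_mul_one_sub_rpow (α := a - 1) (β := b - 1)
    (by linarith) (by linarith)
  have hmem : (a - 1) / ((a - 1) + (b - 1)) ∈ uIcc (0 : ℝ) 1 := by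
    rw [uIcc_of_le zero_le_one]; exact ⟨hm0.le, hm1.le⟩
  have hadd := intervalIntegral.integral_add_adjacent_intervals
    (hint.mono_set (uIcc_subset_uIcc_left hmem)) (hint.mono_set (uIcc_subset_uIcc_right hmem))
  rw [betaMeasure_real_Ioo ha hb le_rfl le_rfl zero_le_one, ← hadd, integral_zero_mode h,
    integral_mode_one h] at h1
  rw [hnull _ hm0.le, betaMeasure_real_Ioo ha hb hm0.le le_rfl hm1.le, integral_mode_one h]
  have hs : a - 1 + (b - 1) ≠ 0 := by rcases h with h | h <;> intro h' <;> linarith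
  generalize ((a - 1) / (a - 1 + (b - 1))) ^ (a - 1) * ((b - 1) / (a - 1 + (b - 1))) ^ (b - 1) = c
    at h1 ⊢
  -- Total mass 1 eliminates both the common value c and the Beta function.
  have h2 : c * ((b - 1) * sideIntegral (b - 1) (a - 1) + (a - 1) * sideIntegral (a - 1) (b - 1)) =
      beta a b * (a - 1 + (b - 1)) := by
    field_simp at h1
    linarith
  have h3 : (b - 1) * sideIntegral (b - 1) (a - 1) + (a - 1) * sideIntegral (a - 1) (b - 1) ≠ 0 := by
    intro h0
    rw [h0, mul_zero] at h2
    exact mul_ne_zero hB.ne' hs h2.symm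
  rw [eq_div_iff h3]
  field_simp
  linear_combination ((b - 1) * sideIntegral (b - 1) (a - 1)) * h2

/-- `α * sideIntegral α β` is, up to a factor symmetric in `α` and `β`, the mass of `[0, m]` under
the density `x ^ α * (1 - x) ^ β`, where `m = α / (α + β)`. -/
noncomputable def sideMass (α β : ℝ) : ℝ := α * sideIntegral α β

/-- Bernoulli's inequality in the form that `q ↦ (1 + v / q) ^ q` is increasing. -/
theorem one_add_div_rpow_le {q q' v : ℝ} (hq : 0 < q) (hqq' : q ≤ q') (hv : -q ≤ v) :
    (1 + v / q) ^ q ≤ (1 + v / q') ^ q' := by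
  have hq' : 0 < q' := hq.trans_le hqq'
  have h1 : -1 ≤ v / q' := by rw [le_div_iff₀ hq']; linarith
  have h0 : 0 ≤ 1 + v / q := by
    have : -1 ≤ v / q := by rw [le_div_iff₀ hq]; linarith
    linarith
  have hB := one_add_mul_self_le_rpow_one_add h1 ((one_le_div hq).2 hqq')
  have e : q' / q * (v / q') = v / q := by field_simp
  rw [e] at hB
  refine (Real.rpow_le_rpow h0 hB hq.le).trans_eq ?_
  rw [← Real.rpow_mul (by linarith), div_mul_cancel₀ _ hq.ne']

/-! ### Negative exponents: the two masses move in opposite directions -/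

section Antimode

variable {A A' B : ℝ}

theorem sideIntegral_neg_le (hA : 0 < A) (hAA' : A ≤ A') (hB : 0 < B) (hB1 : B < 1) :
    sideIntegral (-B) (-A') ≤ sideIntegral (-B) (-A) := by
  have hA' : 0 < A' := hA.trans_le hAA'
  have hq : 0 < -B / -A := by rw [neg_div_neg_eq]; positivity
  have hq' : 0 < -B / -A' := by rw [neg_div_neg_eq]; positivity
  refine intervalIntegral.integral_mono_on_of_le_Ioo zero_le_one
    (intervalIntegrable_sideIntegral (by linarith) hq')
    (intervalIntegrable_sideIntegral (by linarith) hq) fun s hs => ?_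
  have p := one_add_div_mul_one_sub_pos hq hs.2.le
  have p' := one_add_div_mul_one_sub_pos hq' hs.2.le
  refine mul_le_mul_of_nonneg_left ?_ (Real.rpow_nonneg hs.1.le _)
  rw [Real.rpow_neg p.le, Real.rpow_neg p'.le]
  refine inv_anti₀ (Real.rpow_pos_of_pos p _) ?_
  have key := one_add_div_rpow_le (v := B * (1 - s)) hA hAA'
    (by have := mul_nonneg hB.le (sub_nonneg.2 hs.2.le); linarith)
  rwa [mul_div_right_comm, mul_div_right_comm, ← neg_div_neg_eq, ← neg_div_neg_eq B A'] at key

/-- The integrand itself increases with A: the logarithm of the first factor gains at least (A' -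
A)(1 - s), because log s ≤ s - 1, and that of the second loses at most as much. -/
theorem mul_sideIntegral_neg_le (hA : 0 < A) (hAA' : A ≤ A') (hA' : A' < 1) (hB : 0 < B) :
    A * sideIntegral (-A) (-B) ≤ A' * sideIntegral (-A') (-B) := by
  have hA0 : 0 < A' := hA.trans_le hAA'
  have hq : 0 < -A / -B := by rw [neg_div_neg_eq]; positivity
  have hq' : 0 < -A' / -B := by rw [neg_div_neg_eq]; positivity
  refine mul_le_mul hAA' ?_ (sideIntegral_pos (by linarith) hq).le hA0.le
  refine intervalIntegral.integral_mono_on_of_le_Ioo zero_le_one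
    (intervalIntegrable_sideIntegral (by linarith) hq)
    (intervalIntegrable_sideIntegral (by linarith) hq') fun s hs => ?_
  have p := one_add_div_mul_one_sub_pos hq hs.2.le
  have p' := one_add_div_mul_one_sub_pos hq' hs.2.le
  rw [neg_div_neg_eq] at p p' ⊢
  rw [neg_div_neg_eq, Real.rpow_def_of_pos hs.1, Real.rpow_def_of_pos hs.1,
    Real.rpow_def_of_pos p, Real.rpow_def_of_pos p', ← Real.exp_add, ← Real.exp_add,
    Real.exp_le_exp]
  have hs1 : 0 < 1 - s := sub_pos.2 hs.2
  have hlog : Real.log s ≤ s - 1 := Real.log_le_sub_one_of_pos hs.1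
  have h1 := Real.log_le_sub_one_of_pos (div_pos p' p)
  rw [Real.log_div p'.ne' p.ne'] at h1
  have h2 : (1 + A' / B * (1 - s)) / (1 + A / B * (1 - s)) - 1 ≤ (A' - A) / B * (1 - s) := by
    have hn : 0 ≤ (A' - A) / B * (1 - s) :=
      mul_nonneg (div_nonneg (sub_nonneg.2 hAA') hB.le) hs1.le
    have hm : 0 ≤ A / B * (1 - s) := by positivity
    have e : (1 + A' / B * (1 - s)) - (1 + A / B * (1 - s)) = (A' - A) / B * (1 - s) := by ring
    rw [div_sub_one p.ne', e]
    exact div_le_self hn (by linarith)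
  have h3 := mul_le_mul_of_nonneg_left (h1.trans h2) hB.le
  have e3 : B * ((A' - A) / B * (1 - s)) = (A' - A) * (1 - s) := by field_simp
  have h4 := mul_le_mul_of_nonneg_left hlog (sub_nonneg.2 hAA')
  rw [e3] at h3
  linarith

theorem sideMass_mul_sideMass_le_of_neg {α α' β : ℝ} (hα : -1 < α) (hαα' : α ≤ α') (hα' : α' < 0)
    (hβ : -1 < β) (hβ0 : β < 0) :
    sideMass β α * sideMass α' β ≤ sideMass β α' * sideMass α β := by
  have h1 := mul_sideIntegral_neg_le (neg_pos.2 hα') (neg_le_neg hαα') (by linarith)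
    (neg_pos.2 hβ0)
  have h2 := sideIntegral_neg_le (neg_pos.2 hα') (neg_le_neg hαα') (neg_pos.2 hβ0) (by linarith)
  simp only [neg_neg] at h1 h2
  have h3 := mul_le_mul_of_nonneg_left h2 (neg_nonneg.2 hβ0.le)
  have p1 := sideIntegral_pos (α := β) hβ (div_pos_of_neg_of_neg hβ0 hα')
  have p2 := sideIntegral_pos (α := α') (by linarith) (div_pos_of_neg_of_neg hα' hβ0)
  have := mul_le_mul h3 h1 (mul_nonneg (neg_nonneg.2 hα'.le) p2.le)
    (mul_nonneg (neg_nonneg.2 hβ0.le) p1.le)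
  simp only [neg_mul, mul_neg, neg_neg] at this
  exact this

end Antimode

/-! ### Positive exponents: comparing growth rates by rescaling -/

section Mode

/-- The function `x ^ p * (1 - x) ^ q`, normalised and rescaled around its mode. -/
noncomputable def modeKernel (p q v : ℝ) : ℝ := (1 - v / p) ^ p * (1 + v / q) ^ q

theorem continuous_modeKernel {p q : ℝ} (hp : 0 ≤ p) (hq : 0 ≤ q) :
    Continuous (modeKernel p q) := by
  unfold modeKernel
  exact (Continuous.rpow_const (by fun_prop) fun _ => Or.inr hp).mul
    (Continuous.rpow_const (by fun_prop) fun _ => Or.inr hq)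

theorem modeKernel_pos {p q v : ℝ} (hp : 0 < p) (hq : 0 < q) (hv : 0 ≤ v) (hvp : v < p) :
    0 < modeKernel p q v := by
  have : v / p < 1 := (div_lt_one hp).2 hvp
  have : 0 < 1 - v / p := by linarith
  unfold modeKernel
  positivity

theorem sideMass_eq_integral_modeKernel {α β : ℝ} (hα : 0 < α) :
    sideMass α β = ∫ v in (0 : ℝ)..α, modeKernel α β v := by
  have := intervalIntegral.smul_integral_comp_mul_left (a := 0) (b := 1) (modeKernel α β) α
  rw [mul_zero, mul_one, smul_eq_mul] at this
  have h2 := intervalIntegral.integral_comp_sub_left (a := 0) (b := 1)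
    (fun s : ℝ => s ^ α * (1 + α / β * (1 - s)) ^ β) 1
  rw [sub_self, sub_zero] at h2
  rw [← this, sideMass, sideIntegral, ← h2]
  congr 1
  refine intervalIntegral.integral_congr fun s _ => ?_
  simp only [modeKernel, sub_sub_cancel]
  rw [mul_div_cancel_left₀ _ hα.ne', mul_div_right_comm]

theorem sideMass_eq_mul_integral_modeKernel {α β k : ℝ} (hα : 0 < α) (hk : 0 < k) :
    sideMass α β = k * ∫ v in (0 : ℝ)..α / k, modeKernel α β (k * v) := by
  have := intervalIntegral.smul_integral_comp_mul_left (a := 0) (b := α / k) (modeKernel α β) k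
  rw [mul_zero, mul_div_cancel₀ _ hk.ne', smul_eq_mul] at this
  rw [this, sideMass_eq_integral_modeKernel hα]

theorem sideMass_pos {α β : ℝ} (hα : 0 < α) (hβ : 0 < β) : 0 < sideMass α β :=
  mul_pos hα (sideIntegral_pos (by linarith) (div_pos hα hβ))

theorem log_modeKernel {p q v : ℝ} (hp : 0 < p) (hq : 0 < q) (hv : 0 ≤ v) (hvp : v < p) :
    Real.log (modeKernel p q v) = p * Real.log (1 - v / p) + q * Real.log (1 + v / q) := by
  have : v / p < 1 := (div_lt_one hp).2 hvp
  have h1 : 0 < 1 - v / p := by linarith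
  have h2 : 0 < 1 + v / q := by positivity
  rw [modeKernel, Real.log_mul (Real.rpow_pos_of_pos h1 _).ne' (Real.rpow_pos_of_pos h2 _).ne',
    Real.log_rpow h1, Real.log_rpow h2]

theorem hasDerivAt_log_modeKernel {p q k u : ℝ} (hp : 0 < p) (hq : 0 < q) (hu : 0 ≤ k * u)
    (hup : k * u < p) :
    HasDerivAt (fun u => p * Real.log (1 - k * u / p) + q * Real.log (1 + k * u / q))
      (-(k ^ 2 * (p + q) * u / ((p - k * u) * (q + k * u)))) u := by
  have h0 : k * u / p < 1 := (div_lt_one hp).2 hup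
  have h1 : 1 - k * u / p ≠ 0 := by linarith
  have h2 : 1 + k * u / q ≠ 0 := by positivity
  have h3 : p - k * u ≠ 0 := by linarith
  have h4 : q + k * u ≠ 0 := by positivity
  have d0 : HasDerivAt (fun u : ℝ => k * u) k u := by
    simpa using (hasDerivAt_id u).const_mul k
  have d1 := (((d0.div_const p).const_sub 1).log h1).const_mul p
  have d2 := (((d0.div_const q).const_add 1).log h2).const_mul q
  refine (d1.add d2).congr_deriv ?_
  have e1 : 1 - k * u / p = (p - k * u) / p := by field_simp
  have e2 : 1 + k * u / q = (q + k * u) / q := by field_simp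
  rw [e1, e2]
  field_simp
  ring

/-- Both kernels equal 1 at u = 0, and `h` says, with denominators cleared, that the logarithm of
the one on the left decreases at least as fast. -/
theorem modeKernel_mul_le {p q p' q' j k T : ℝ} (hp : 0 < p) (hq : 0 < q) (hp' : 0 < p')
    (hq' : 0 < q') (hj : 0 < j) (hk : 0 < k) (hkT : k * T ≤ p) (hjT : j * T ≤ p')
    (h : ∀ u ∈ Ioo 0 T, k ^ 2 * (p + q) * ((p' - j * u) * (q' + j * u)) ≤
      j ^ 2 * (p' + q') * ((p - k * u) * (q + k * u)))
    {u : ℝ} (hu : u ∈ Ioo 0 T) : modeKernel p' q' (j * u) ≤ modeKernel p q (k * u) := by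
  have bk : ∀ {u}, u ∈ Ico 0 T → 0 ≤ k * u ∧ k * u < p := fun hu =>
    ⟨mul_nonneg hk.le hu.1, (mul_lt_mul_of_pos_left hu.2 hk).trans_le hkT⟩
  have bj : ∀ {u}, u ∈ Ico 0 T → 0 ≤ j * u ∧ j * u < p' := fun hu =>
    ⟨mul_nonneg hj.le hu.1, (mul_lt_mul_of_pos_left hu.2 hj).trans_le hjT⟩
  have hd : ∀ u ∈ Ico 0 T, HasDerivAt
      ((fun u => p * Real.log (1 - k * u / p) + q * Real.log (1 + k * u / q)) -
        fun u => p' * Real.log (1 - j * u / p') + q' * Real.log (1 + j * u / q'))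
      (-(k ^ 2 * (p + q) * u / ((p - k * u) * (q + k * u))) -
        -(j ^ 2 * (p' + q') * u / ((p' - j * u) * (q' + j * u)))) u := fun u hu =>
    (hasDerivAt_log_modeKernel hp hq (bk hu).1 (bk hu).2).sub
      (hasDerivAt_log_modeKernel hp' hq' (bj hu).1 (bj hu).2)
  have hmono := monotoneOn_of_deriv_nonneg (convex_Ico 0 T)
    (fun u hu => (hd u hu).continuousAt.continuousWithinAt)
    (fun u hu => (hd u (interior_subset hu)).differentiableAt.differentiableWithinAt)
    (fun u hu => by
      have hu' := interior_subset hu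
      rw [interior_Ico] at hu
      rw [(hd u hu').deriv, neg_sub_neg, sub_nonneg]
      have b1 := bk hu'
      have b2 := bj hu'
      have c1 : 0 < (p - k * u) * (q + k * u) := mul_pos (by linarith) (by linarith)
      have c2 : 0 < (p' - j * u) * (q' + j * u) := mul_pos (by linarith) (by linarith)
      rw [div_le_div_iff₀ c1 c2]
      have := mul_le_mul_of_nonneg_right (h u hu) hu.1.le
      linarith)
  have hu' := Ioo_subset_Ico_self hu
  have := hmono ⟨le_rfl, hu.1.trans hu.2⟩ hu' hu.1.le
  simp only [Pi.sub_apply, mul_zero, zero_div, sub_zero, add_zero, Real.log_one, sub_self] at this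
  rw [← log_modeKernel hp hq (bk hu').1 (bk hu').2,
    ← log_modeKernel hp' hq' (bj hu').1 (bj hu').2, sub_nonneg] at this
  exact (Real.log_le_log_iff (modeKernel_pos hp' hq' (bj hu').1 (bj hu').2)
    (modeKernel_pos hp hq (bk hu').1 (bk hu').2)).1 this

theorem sideMass_le_right {α α' β : ℝ} (hα : 0 < α) (hαα' : α ≤ α') (hβ : 0 < β) :
    sideMass β α ≤ sideMass β α' := by
  have hα' := hα.trans_le hαα'
  rw [sideMass_eq_integral_modeKernel hβ, sideMass_eq_integral_modeKernel hβ]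
  refine intervalIntegral.integral_mono_on hβ.le
    ((continuous_modeKernel hβ.le hα.le).intervalIntegrable _ _)
    ((continuous_modeKernel hβ.le hα'.le).intervalIntegrable _ _) fun v hv => ?_
  have h1 : 0 ≤ 1 - v / β := sub_nonneg.2 ((div_le_one hβ).2 hv.2)
  exact mul_le_mul_of_nonneg_left (one_add_div_rpow_le hα hαα' (by linarith [hv.1]))
    (Real.rpow_nonneg h1 _)

theorem integral_modeKernel_le_sideMass {α β T : ℝ} (hα : 0 < α) (hβ : 0 < β) (hT0 : 0 ≤ T)
    (hT : T ≤ α) : ∫ v in (0 : ℝ)..T, modeKernel α β v ≤ sideMass α β := by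
  rw [sideMass_eq_integral_modeKernel hα]
  refine intervalIntegral.integral_mono_interval le_rfl hT0 hT ?_
    ((continuous_modeKernel hα.le hβ.le).intervalIntegrable _ _)
  refine ae_restrict_of_forall_mem measurableSet_Ioc fun v hv => ?_
  have h1 : 0 ≤ 1 - v / α := sub_nonneg.2 ((div_le_one hα).2 hv.2)
  have := hv.1
  simp only [Pi.zero_apply, modeKernel]
  positivity

theorem sideMass_le_left {α α' β : ℝ} (hα : 0 < α) (hαα' : α ≤ α') (hβ : 0 < β) :
    sideMass α β ≤ sideMass α' β := by
  have hα' := hα.trans_le hαα'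
  refine le_trans ?_ (integral_modeKernel_le_sideMass hα' hβ hα.le hαα')
  rw [sideMass_eq_integral_modeKernel hα]
  refine intervalIntegral.integral_mono_on hα.le
    ((continuous_modeKernel hα.le hβ.le).intervalIntegrable _ _)
    ((continuous_modeKernel hα'.le hβ.le).intervalIntegrable _ _) fun v hv => ?_
  have h1 : 0 ≤ 1 + v / β := by have := hv.1; positivity
  -- Bernoulli is used here with a negative increment, for the factor that vanishes at v = α.
  have := one_add_div_rpow_le (v := -v) hα hαα' (by linarith [hv.2])
  rw [neg_div, neg_div, ← sub_eq_add_neg, ← sub_eq_add_neg] at this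
  exact mul_le_mul_of_nonneg_right this (Real.rpow_nonneg h1 _)

/-- Otherwise the rescaled kernel for α dominates the kernel for α' on (0, β). It also has positive
mass on (β, β / k), since k < 1, so the two areas could not be equal. -/
theorem exists_lt_of_sideMass_eq {α α' β k : ℝ} (hα : 0 < α) (hα' : 0 < α') (hβ : 0 < β)
    (hk : 0 < k) (hk1 : k < 1) (h : sideMass β α = k * sideMass β α') :
    ∃ u ∈ Ioo 0 β, (α' + β) * ((α + k * u) * (β - k * u)) <
      (α + β) * k ^ 2 * ((α' + u) * (β - u)) := by
  by_contra! hQ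
  have hcont : Continuous fun v => modeKernel β α (k * v) :=
    (continuous_modeKernel hβ.le hα.le).comp (continuous_const_mul k)
  have hβk : β < β / k := by rw [lt_div_iff₀ hk]; nlinarith
  have hU : ∫ v in (0 : ℝ)..β / k, modeKernel β α (k * v) = sideMass β α' := by
    rw [sideMass_eq_mul_integral_modeKernel hβ hk] at h
    exact mul_left_cancel₀ hk.ne' h
  rw [← intervalIntegral.integral_add_adjacent_intervals (b := β)
    (hcont.intervalIntegrable _ _) (hcont.intervalIntegrable _ _)] at hU
  have htail : 0 < ∫ v in β..β / k, modeKernel β α (k * v) := by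
    refine intervalIntegral.intervalIntegral_pos_of_pos_on (hcont.intervalIntegrable _ _)
      (fun v hv => ?_) hβk
    refine modeKernel_pos hβ hα (mul_nonneg hk.le (hβ.trans hv.1).le) ?_
    rw [mul_comm, ← lt_div_iff₀ hk]
    exact hv.2
  have hmono : sideMass β α' ≤ ∫ v in (0 : ℝ)..β, modeKernel β α (k * v) := by
    rw [sideMass_eq_integral_modeKernel hβ]
    refine intervalIntegral.integral_mono_on_of_le_Ioo hβ.le
      ((continuous_modeKernel hβ.le hα'.le).intervalIntegrable _ _)
      (hcont.intervalIntegrable _ _) fun v hv => ?_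
    have := modeKernel_mul_le (q' := α') hβ hα hβ hα' one_pos hk (T := β) (by nlinarith) (by simp)
      (fun u hu => by have := hQ u hu; simp only [one_mul]; linarith) hv
    rwa [one_mul] at this
  linarith

theorem sideMass_mul_sideMass_le_of_pos {α α' β : ℝ} (hα : 0 < α) (hαα' : α ≤ α') (hβ : 0 < β) :
    sideMass β α' * sideMass α β ≤ sideMass β α * sideMass α' β := by
  have hα' := hα.trans_le hαα'
  have pU := sideMass_pos hβ hα
  have pU' := sideMass_pos hβ hα'
  -- Equality would give k = 1, with no tail left beyond β; monotonicity of the lower mass then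
  -- suffices.
  rcases (sideMass_le_right hα hαα' hβ).eq_or_lt with hU | hU
  · rw [hU]
    exact mul_le_mul_of_nonneg_left (sideMass_le_left hα hαα' hβ) pU'.le
  obtain ⟨k, hk⟩ : ∃ k, k = sideMass β α / sideMass β α' := ⟨_, rfl⟩
  have hk0 : 0 < k := hk ▸ div_pos pU pU'
  have hk1 : k < 1 := hk ▸ (div_lt_one pU').2 hU
  have hkU : sideMass β α = k * sideMass β α' := by rw [hk, div_mul_cancel₀ _ pU'.ne']
  obtain ⟨u₀, hu₀, hQ₀⟩ := exists_lt_of_sideMass_eq hα hα' hβ hk0 hk1 hkU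
  -- With Q(w) = (α + β) k² (α' + w)(β - w) - (α' + β)(α + k w)(β - k w), this says Q(-u) > 0. The
  -- leading coefficient (α' - α) k² is nonnegative, and Q(β) < 0 < Q(u₀) with -u ≤ u₀ < β.
  have hQ : ∀ u, 0 ≤ u → (α' + β) * ((α - k * u) * (β + k * u)) <
      (α + β) * k ^ 2 * ((α' - u) * (β + u)) := by
    intro u hu
    have hQβ : 0 < (α' + β) * ((α + k * β) * (β * (1 - k))) := by
      have := sub_pos.2 hk1
      positivity
    have h1 : 0 < u₀ + u := by linarith [hu₀.1]
    have h2 : 0 < β - u₀ := sub_pos.2 hu₀.2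
    have h3 : 0 < β + u := by linarith
    -- The convexity defect of Q at -u, u₀, β: (β - u₀) Q(-u) equals (β + u) Q(u₀) - (u₀ + u) Q(β)
    -- plus this term.
    have h4 : 0 ≤ (α' - α) * k ^ 2 * ((β + u) * (u₀ + u) * (β - u₀)) :=
      mul_nonneg (mul_nonneg (sub_nonneg.2 hαα') (sq_nonneg k)) (by positivity)
    have h5 := mul_lt_mul_of_pos_left hQ₀ h3
    have h6 := mul_pos h1 hQβ
    refine lt_of_mul_lt_mul_left ?_ h2.le
    linarith
  -- At u = α' the right side of `hQ` vanishes, so α - k α' must be negative.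
  have hαk : α / k ≤ α' := by
    rw [div_le_iff₀ hk0]
    by_contra! hlt
    have := hQ α' hα'.le
    rw [sub_self, zero_mul, mul_zero] at this
    have h1 : 0 < α - k * α' := by linarith
    exact absurd this (not_lt.2 (by positivity))
  have hL : sideMass α β ≤ k * sideMass α' β := by
    rw [sideMass_eq_mul_integral_modeKernel hα hk0]
    refine mul_le_mul_of_nonneg_left (le_trans ?_
      (integral_modeKernel_le_sideMass hα' hβ (div_pos hα hk0).le hαk)) hk0.le
    refine intervalIntegral.integral_mono_on_of_le_Ioo (div_pos hα hk0).le
      (((continuous_modeKernel hα.le hβ.le).comp (continuous_const_mul k)).intervalIntegrable _ _)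
      ((continuous_modeKernel hα'.le hβ.le).intervalIntegrable _ _) fun v hv => ?_
    have := modeKernel_mul_le (p := α') (q := β) (p' := α) (q' := β) (T := α / k) hα' hβ hα hβ hk0
      one_pos (by rwa [one_mul]) (by rw [mul_div_cancel₀ _ hk0.ne'])
      (fun u hu => by have := hQ u hu.1.le; simp only [one_mul]; linarith) hv
    rwa [one_mul] at this
  rw [hkU, mul_right_comm, mul_comm (k * _)]
  nlinarith [mul_le_mul_of_nonneg_left hL pU'.le]

end Mode

/-! ### From cross products to probabilities -/

/-- Asking only that the product of the denominators be positive covers both regimes, in which the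
sums are both positive or both negative. -/
theorem div_add_le_div_add {u l u' l' : ℝ} (h : 0 < (u + l) * (u' + l')) (hul : u * l' ≤ u' * l) :
    u / (u + l) ≤ u' / (u' + l') := by
  have h1 : u + l ≠ 0 := left_ne_zero_of_mul h.ne'
  have h2 : u' + l' ≠ 0 := right_ne_zero_of_mul h.ne'
  rw [← sub_nonneg, div_sub_div _ _ h2 h1]
  refine div_nonneg ?_ (by linarith)
  linarith

theorem sideMass_add_neg {α β : ℝ} (hα : -1 < α) (hα0 : α < 0) (hβ : -1 < β) (hβ0 : β < 0) :
    sideMass β α + sideMass α β < 0 :=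
  add_neg (mul_neg_of_neg_of_pos hβ0 (sideIntegral_pos hβ (div_pos_of_neg_of_neg hβ0 hα0)))
    (mul_neg_of_neg_of_pos hα0 (sideIntegral_pos hα (div_pos_of_neg_of_neg hα0 hβ0)))

theorem corollary11 {Ω : ℝ → ℝ → Type*} [∀ a b, MeasurableSpace (Ω a b)]
    (P : ∀ a b, Measure (Ω a b)) (X : ∀ a b, Ω a b → ℝ)
    (hX : ∀ a b, 0 < a → 0 < b → HasLaw (X a b) (betaMeasure a b) (P a b)) :
    ((∀ a b, 1 < a → 1 < b → ∃! m, IsMode (betaMeasure a b) m) ∧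
      ∀ mode : ℝ → ℝ → ℝ,
        (∀ a b, 1 < a → 1 < b → IsMode (betaMeasure a b) (mode a b)) →
        (∀ b, 1 < b →
          AntitoneOn (fun a => (P a b).real {ω | mode a b < X a b ω}) (Ioi 1)) ∧
        (∀ a, 1 < a →
          MonotoneOn (fun b => (P a b).real {ω | mode a b < X a b ω}) (Ioi 1))) ∧
    ((∀ a b, a ∈ Ioo 0 1 → b ∈ Ioo 0 1 → ∃! m, IsAntimode (betaMeasure a b) m) ∧
      ∀ antimode : ℝ → ℝ → ℝ,
        (∀ a b, a ∈ Ioo 0 1 → b ∈ Ioo 0 1 → IsAntimode (betaMeasure a b) (antimode a b)) →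
        (∀ b, b ∈ Ioo 0 1 →
          MonotoneOn (fun a => (P a b).real {ω | antimode a b < X a b ω}) (Ioo 0 1)) ∧
        (∀ a, a ∈ Ioo 0 1 →
          AntitoneOn (fun b => (P a b).real {ω | antimode a b < X a b ω}) (Ioo 0 1))) := by
  have hprob : ∀ a b, 0 < a → 0 < b → 0 < a - 1 ∧ 0 < b - 1 ∨ a - 1 < 0 ∧ b - 1 < 0 →
      (P a b).real {ω | (a - 1) / ((a - 1) + (b - 1)) < X a b ω} =
        sideMass (b - 1) (a - 1) / (sideMass (b - 1) (a - 1) + sideMass (a - 1) (b - 1)) :=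
    fun a b ha hb h => ((hX a b ha hb).measureReal_eq measurableSet_Ioi).trans
      (betaMeasure_real_Ioi_mode ha hb h)
  refine ⟨⟨fun a b ha hb => ⟨_, isMode_betaMeasure ha hb, fun m hm =>
    eq_of_isMode_betaMeasure (by linarith) (by linarith) hm (isMode_betaMeasure ha hb)⟩,
    fun mode hmode => ?_⟩, fun a b ha hb => ⟨_, isAntimode_betaMeasure ha hb, fun m hm =>
    eq_of_isAntimode_betaMeasure ha.1 hb.1 hm (isAntimode_betaMeasure ha hb)⟩,
    fun antimode hanti => ?_⟩
  · have hP : ∀ a b, 1 < a → 1 < b → (P a b).real {ω | mode a b < X a b ω} =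
        sideMass (b - 1) (a - 1) / (sideMass (b - 1) (a - 1) + sideMass (a - 1) (b - 1)) := by
      intro a b ha hb
      rw [eq_of_isMode_betaMeasure (by linarith) (by linarith) (hmode a b ha hb)
        (isMode_betaMeasure ha hb)]
      exact hprob a b (by linarith) (by linarith) (Or.inl ⟨by linarith, by linarith⟩)
    have hpos : ∀ a b : ℝ, 1 < a → 1 < b →
        0 < sideMass (b - 1) (a - 1) + sideMass (a - 1) (b - 1) := fun a b ha hb =>
      add_pos (sideMass_pos (sub_pos.2 hb) (sub_pos.2 ha))
        (sideMass_pos (sub_pos.2 ha) (sub_pos.2 hb))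
    refine ⟨fun b hb a ha a' ha' haa' => ?_, fun a ha b hb b' hb' hbb' => ?_⟩
    · simp only
      rw [hP a b ha hb, hP a' b ha' hb]
      exact div_add_le_div_add (mul_pos (hpos a' b ha' hb) (hpos a b ha hb))
        (sideMass_mul_sideMass_le_of_pos (sub_pos.2 ha) (sub_le_sub_right haa' 1) (sub_pos.2 hb))
    · simp only
      rw [hP a b ha hb, hP a b' ha hb']
      refine div_add_le_div_add (mul_pos (hpos a b ha hb) (hpos a b' ha hb')) ?_
      -- Exchanging the parameters exchanges the two masses, so monotonicity in b is the inequality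
      -- for a read backwards.
      rw [mul_comm, mul_comm (sideMass (b' - 1) _)]
      exact sideMass_mul_sideMass_le_of_pos (sub_pos.2 hb) (sub_le_sub_right hbb' 1) (sub_pos.2 ha)
  · have hP : ∀ a b, a ∈ Ioo (0 : ℝ) 1 → b ∈ Ioo (0 : ℝ) 1 →
        (P a b).real {ω | antimode a b < X a b ω} =
        sideMass (b - 1) (a - 1) / (sideMass (b - 1) (a - 1) + sideMass (a - 1) (b - 1)) := by
      intro a b ha hb
      rw [eq_of_isAntimode_betaMeasure ha.1 hb.1 (hanti a b ha hb) (isAntimode_betaMeasure ha hb)]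
      exact hprob a b ha.1 hb.1 (Or.inr ⟨sub_neg.2 ha.2, sub_neg.2 hb.2⟩)
    have hneg : ∀ a b : ℝ, a ∈ Ioo (0 : ℝ) 1 → b ∈ Ioo (0 : ℝ) 1 →
        sideMass (b - 1) (a - 1) + sideMass (a - 1) (b - 1) < 0 := fun a b ha hb =>
      sideMass_add_neg (by linarith [ha.1]) (sub_neg.2 ha.2) (by linarith [hb.1]) (sub_neg.2 hb.2)
    refine ⟨fun b hb a ha a' ha' haa' => ?_, fun a ha b hb b' hb' hbb' => ?_⟩
    · simp only
      rw [hP a b ha hb, hP a' b ha' hb]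
      exact div_add_le_div_add (mul_pos_of_neg_of_neg (hneg a b ha hb) (hneg a' b ha' hb))
        (sideMass_mul_sideMass_le_of_neg (by linarith [ha.1]) (sub_le_sub_right haa' 1)
          (sub_neg.2 ha'.2) (by linarith [hb.1]) (sub_neg.2 hb.2))
    · simp only
      rw [hP a b ha hb, hP a b' ha hb']
      refine div_add_le_div_add (mul_pos_of_neg_of_neg (hneg a b' ha hb') (hneg a b ha hb)) ?_
      rw [mul_comm, mul_comm (sideMass (b - 1) _)]
      exact sideMass_mul_sideMass_le_of_neg (by linarith [hb.1]) (sub_le_sub_right hbb' 1)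
        (sub_neg.2 hb'.2) (by linarith [ha.1]) (sub_neg.2 ha.2)
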